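/- Let $K$ be an algebraically closed field that is complete with respect to a nontrivial non-Archimedean absolute value $|\cdot|$. Give $\mathbb{P}^1(K)$ the topology generated by the open balls $\{x\in K:|x-a|<r\}$ and the complements $\mathbb{P}^1(K)\setminus\{x\in K:|x-a|\le r\}$ of closed balls ($a\in K$, $r>0$). A $2\times 2$ matrix is hyperbolic if it has two eigenvalues with different absolute values. Let $\Gamma\le PGL(2,K)$ be a Schottky group, i.e. a finitely generated subgroup in which every non-identity element is hyperbolic, acting on $\mathbb{P}^1(K)$ in the usual way. Let $\Sigma\subset\mathbb{P}^1(K)$ (the set of bad points) be the set of fixed points of non-identity elements of $\Gamma$ together with the limit points of the set of these fixed points. In the analytic projective line $(\mathbb{P}^1)^{an}$, whose points are the points of $\mathbb{P}^1(K)$ (type 1), the closed balls $B(c,t)^+=\{x\in K:|x-c|\le t\}$ with $c\in K$, $t>0$ (types 2 and 3), and the equivalence classes of nested sequences of closed balls with empty intersection (type 4), the path connecting two distinct type 1 points $x,y$ consists of $x$, $y$ and, if $x,y\in K$, of all $B(x,t)^+$ and $B(y,t)^+$ with $0<t\le|x-y|$, respectively, if one of the two points is $\infty$ and the other is $c\in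 K$, of all $B(c,t)^+$ with $t>0$; the path from a type 1 point to itself is that point. For $S\subset\mathbb{P}^1(K)$, the subtree $T(S)$ of $(\mathbb{P}^1)^{an}$ spanned by $S$ is the union of all paths connecting pairs of points of $S$, where the type 1 points (the ends of the tree, at infinite distance) are not counted as points of the tree. Let $a\in K$, and assume that $\Gamma$ is not abelian (for a free group $\Gamma$ this means rank $g\ge 2$) or that $a\notin\Sigma$. Then $T(\Gamma a)\supset T(\Sigma)$. Furthermore, if $a\in\Sigma$, then $T(\Gamma a)=T(\Sigma)$. -/

import Mathlib

open scoped LinearAlgebra.Projectivization MatrixGroups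

noncomputable section

namespace Mumford

variable (K : Type*) [NontriviallyNormedField K]

/-- The projective line `ℙ¹(K)`. The group `PGL(2, K)` acts on it through column vectors. -/
abbrev P1 : Type _ := ℙ K (Fin 2 → K)

variable {K}

/-- The affine point `a = (a : 1)`. -/
def affinePt (a : K) : P1 K :=
  Projectivization.mk K ![a, 1] (by simp)

variable (K) in
/-- The point at infinity `∞ = (1 : 0)`. -/
def inftyPt : P1 K :=
  Projectivization.mk K ![1, 0] (by simp)

/-- Open balls in `ℙ¹(K)`: the usual open balls, and the complements of the usual closed balls. -/
def IsOpenBallP1 (U : Set (P1 K)) : Prop :=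
  ∃ (a : K) (r : ℝ), 0 < r ∧
    (U = affinePt '' Metric.ball a r ∨ U = (affinePt '' Metric.closedBall a r)ᶜ)

variable (K) in
/-- The topology of `ℙ¹(K)`, generated by the open balls. -/
abbrev topologyP1 : TopologicalSpace (P1 K) :=
  TopologicalSpace.generateFrom {U | IsOpenBallP1 U}

/-- A `2 × 2` matrix is hyperbolic if it has two eigenvalues with different valuations. -/
def IsHyperbolicMatrix (A : Matrix (Fin 2) (Fin 2) K) : Prop :=
  ∃ l m : K, Module.End.HasEigenvalue (Matrix.toLin' A) l ∧
    Module.End.HasEigenvalue (Matrix.toLin' A) m ∧ ‖l‖ ≠ ‖m‖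

/-- An element of `PGL(2, K)` is hyperbolic if a matrix representing it is hyperbolic
(this does not depend on the representative). -/
def IsHyperbolic (g : PGL(2, K)) : Prop :=
  ∃ A : GL (Fin 2) K, Matrix.ProjGenLinGroup.mk A = g ∧
    IsHyperbolicMatrix (A : Matrix (Fin 2) (Fin 2) K)

/-- A Schottky group is a finitely generated subgroup of `PGL(2, K)` all of whose non-identity
elements are hyperbolic. -/
def IsSchottky (G : Subgroup PGL(2, K)) : Prop :=
  G.FG ∧ ∀ g ∈ G, g ≠ 1 → IsHyperbolic g

/-- The fixed points in `ℙ¹(K)` of the non-identity elements of `G`. -/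
def fixedPts (G : Subgroup PGL(2, K)) : Set (P1 K) :=
  {x | ∃ g ∈ G, g ≠ 1 ∧ g • x = x}

/-- The set `Σ` of bad points: the fixed points of non-identity elements, and the limit points
of the set of these fixed points. -/
def badPts (G : Subgroup PGL(2, K)) : Set (P1 K) :=
  fixedPts G ∪ @derivedSet (P1 K) (topologyP1 K) (fixedPts G)

/-! ### The analytic projective line -/

variable (K) in
/-- The closed balls `B(a, r)⁺` of `K` with `r > 0`, as subsets of `K`. -/
def ClosedBall : Type _ :=
  {B : Set K // ∃ (a : K) (r : ℝ), 0 < r ∧ B = Metric.closedBall a r}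

/-- The closed ball `B(a, r)⁺`. -/
def ClosedBall.mk (a : K) (r : ℝ) (hr : 0 < r) : ClosedBall K :=
  ⟨Metric.closedBall a r, a, r, hr, rfl⟩

variable (K) in
/-- Decreasing sequences of closed balls with empty intersection. -/
structure NestedBalls where
  /-- The sequence of balls. -/
  seq : ℕ → ClosedBall K
  anti : ∀ n, (seq (n + 1)).1 ⊆ (seq n).1
  inter_eq_empty : ⋂ n, (seq n).1 = ∅

variable (K) in
/-- Two nested sequences are equivalent if each ball of either one contains a ball of the
other one. -/
def NestedBalls.setoid : Setoid (NestedBalls K) where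
  r S T := (∀ n, ∃ m, (T.seq m).1 ⊆ (S.seq n).1) ∧ (∀ n, ∃ m, (S.seq m).1 ⊆ (T.seq n).1)
  iseqv :=
    { refl := fun _ => ⟨fun n => ⟨n, subset_rfl⟩, fun n => ⟨n, subset_rfl⟩⟩
      symm := fun h => ⟨h.2, h.1⟩
      trans := fun {S T U} h₁ h₂ => by
        refine ⟨fun n => ?_, fun n => ?_⟩
        · obtain ⟨m, hm⟩ := h₁.1 n
          obtain ⟨k, hk⟩ := h₂.1 m
          exact ⟨k, hk.trans hm⟩
        · obtain ⟨m, hm⟩ := h₂.2 n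
          obtain ⟨k, hk⟩ := h₁.2 m
          exact ⟨k, hk.trans hm⟩ }

variable (K) in
/-- The points of the analytic projective line `(ℙ¹)ᵃⁿ` (for algebraically closed complete `K`).
* Type 1: the points of `ℙ¹(K)`.
* Types 2 and 3: the closed balls `B(a, r)⁺`, with `r ∈ |Kˣ|` (type 2) or `r ∉ |Kˣ|` (type 3).
* Type 4: equivalence classes of nested sequences of closed balls with empty intersection. -/
inductive P1an : Type _
  | typeOne (x : P1 K) : P1an
  | ofBall (B : ClosedBall K) : P1an
  | typeFour (q : Quotient (NestedBalls.setoid K)) : P1an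

/-- The point of `(ℙ¹)ᵃⁿ` corresponding to `B(a, r)⁺`. -/
def ballPt (a : K) (r : ℝ) (hr : 0 < r) : P1an K :=
  P1an.ofBall (ClosedBall.mk a r hr)

/-- The half-open segment of the points `B(a, t)⁺` with `0 < t ≤ r`, going from the smallest balls
around `a` (the end `a` is not included) up to `B(a, r)⁺`. It is empty for `r = 0`. -/
def segmentUpTo (a : K) (r : ℝ) : Set (P1an K) :=
  {P | ∃ (t : ℝ) (ht : 0 < t), t ≤ r ∧ P = ballPt a t ht}

/-- The open ray of all points `B(a, t)⁺` with `t > 0`, joining `a` to `∞`. -/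
def openRay (a : K) : Set (P1an K) :=
  {P | ∃ (t : ℝ) (ht : 0 < t), P = ballPt a t ht}

/-- The path in `(ℙ¹)ᵃⁿ` connecting the type 1 points `x` and `y`, including these two ends.
* For `x = a` and `y = b` in `K`: it goes up from `a` along the balls around `a` to `B(a, |a - b|)⁺`,
  which is the smallest closed ball that contains both, and down along the balls around `b`.
* For `x = a` in `K` and `y = ∞` (or conversely): it passes through all closed balls around `a`.
* If `x = y`, it is the single point `x`. -/
def path (x y : P1 K) : Set (P1an K) :=
  {P | P = P1an.typeOne x ∨ P = P1an.typeOne y ∨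
    (∃ a b : K, x = affinePt a ∧ y = affinePt b ∧
      P ∈ segmentUpTo a ‖a - b‖ ∪ segmentUpTo b ‖a - b‖) ∨
    (∃ a : K, x = affinePt a ∧ y = inftyPt K ∧ P ∈ openRay a) ∨
    (∃ b : K, x = inftyPt K ∧ y = affinePt b ∧ P ∈ openRay b)}

/-- The subtree `T(S)` of `(ℙ¹)ᵃⁿ` spanned by `S ⊆ ℙ¹(K)`: the union of all paths connecting pairs
of points of `S`, where the type 1 points (which lie at infinite distance and are the ends of the
tree) are not counted as points of the tree. -/
def spannedSubtree (S : Set (P1 K)) : Set (P1an K) :=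
  (⋃ x ∈ S, ⋃ y ∈ S, path x y) \ Set.range P1an.typeOne

end Mumford

end

/-!
A hyperbolic `g` has two fixed points, and under the powers of `g` every point other than one of
them converges to the other one. So every fixed point of `g ∈ Γ` lies in the closure of `Γ x`, as
soon as `Γ x` contains a point different from the opposite fixed point. This fails only if `x` is
fixed by all of `Γ`. In that case commutators are unipotent, hence not hyperbolic, so that `Γ` is
abelian; and `x` is a bad point, except in the case `Γ = 1`, where there are no bad points. Hence
`Σ` is contained in the closure of `Γ x`.

A point `B(b, t)⁺` lies on a path starting from `b ∈ S` if and only if the open ball of radius `t`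
around `b` does not contain `S`. Since these balls are open and closed in `ℙ¹(K)`, passing from `S`
to its closure does not enlarge `T(S)`.
-/

namespace Mumford

open Filter Topology Module.End
open scoped commutatorElement

section Attracts

variable {M X : Type*} [TopologicalSpace X]

/-- Under the powers of `g`, all points except for `x'` converge to `x`. For a hyperbolic element
of `PGL(2, K)` this holds with `x` the attracting and `x'` the repelling fixed point. -/
def Attracts [Monoid M] [MulAction M X] (g : M) (x x' : X) : Prop :=
  ∀ y, y ≠ x' → Tendsto (fun n : ℕ => g ^ n • y) atTop (𝓝 x)

theorem Attracts.eq_or_eq_of_smul_eq [Monoid M] [MulAction M X] [T1Space X] {g : M} {x x' z : X}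
    (h : Attracts g x x') (hz : g • z = z) : z = x ∨ z = x' := by
  refine or_iff_not_imp_right.2 fun hzx' => tendsto_const_nhds_iff.1 ((h z hzx').congr fun n => ?_)
  rw [← smul_iterate_apply, Function.iterate_fixed hz]

theorem Attracts.mem_closure_orbit [Group M] [MulAction M X] {G : Subgroup M} {g : M} {x x' y : X}
    (h : Attracts g x x') (hg : g ∈ G) (hy : y ≠ x') : x ∈ closure (MulAction.orbit G y) :=
  mem_closure_of_tendsto (h y hy) (Eventually.of_forall fun n => ⟨⟨g ^ n, G.pow_mem hg n⟩, rfl⟩)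

end Attracts

theorem commutator_smul_eq_of_smul_eq {M U V : Type*} [Group M] [MulAction M V] [CommGroup U]
    [MulAction U V] [SMulCommClass M U V] {A B : M} {b c : U} {v : V} (hA : A • v = b • v)
    (hB : B • v = c • v) : ⁅A, B⁆ • v = v := by
  have hBA : (B * A) • v = (b * c) • v := by rw [mul_smul, hA, smul_comm, hB, smul_smul]
  have hAB : (A * B) • v = (b * c) • v := by
    rw [mul_smul, hB, smul_comm, hA, smul_smul, mul_comm]
  refine MulAction.injective (b * c) ?_
  calc (b * c) • ⁅A, B⁆ • v = ⁅A, B⁆ • (B * A) • v := by rw [hBA, smul_comm ⁅A, B⁆]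
    _ = (A * B) • v := by rw [smul_smul, commutatorElement_def]; group
    _ = (b * c) • v := hAB

section LinearAlgebra

variable {K : Type*} [Field K]

section Eigenvectors

variable {V : Type*} [AddCommGroup V] [Module K V] {φ : Module.End K V} {l m : K} {e f : V}

theorem exists_smul_add_smul_eq_of_hasEigenvector (hV : Module.finrank K V = 2)
    (he : φ.HasEigenvector l e) (hf : φ.HasEigenvector m f) (hlm : l ≠ m) (v : V) :
    ∃ α β : K, α • e + β • f = v := by
  have hinj : Function.Injective ![l, m] := by
    simpa [Function.Injective, Fin.forall_fin_two] using ⟨hlm, hlm.symm⟩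
  have hindep : LinearIndependent K ![e, f] :=
    eigenvectors_linearIndependent' φ ![l, m] hinj ![e, f] (by simp [Fin.forall_fin_two, he, hf])
  have hspan := hindep.span_eq_top_of_card_eq_finrank (by simp [hV])
  rw [Matrix.range_cons_cons_empty] at hspan
  exact Submodule.mem_span_pair.1 (hspan ▸ Submodule.mem_top)

theorem pow_smul_add_smul_of_hasEigenvector (he : φ.HasEigenvector l e)
    (hf : φ.HasEigenvector m f) (hl : l ≠ 0) {α : K} (hα : α ≠ 0) (β : K) (n : ℕ) :
    (φ ^ n) (α • e + β • f) = (α * l ^ n) • (e + (β / α * (m / l) ^ n) • f) := by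
  rw [map_add, map_smul, map_smul, he.pow_apply, hf.pow_apply, smul_add, smul_smul, smul_smul,
    smul_smul, div_pow]
  congr 2
  field_simp

end Eigenvectors

section GeneralLinearGroup

variable {n : Type*} [Fintype n] [DecidableEq n] {A : GL n K} {l : K} {v : n → K}

theorem ne_zero_of_hasEigenvector (h : HasEigenvector (Matrix.toLin' A.1) l v) : l ≠ 0 := by
  rintro rfl
  exact (smul_ne_zero_iff_ne A).2 h.2 (h.apply_eq_smul.trans (zero_smul K v))

theorem hasEigenvector_inv (h : HasEigenvector (Matrix.toLin' A.1) l v) :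
    HasEigenvector (Matrix.toLin' A⁻¹.1) l⁻¹ v := by
  have hA : A • v = l • v := h.apply_eq_smul
  refine ⟨mem_eigenspace_iff.2 (?_ : A⁻¹ • v = l⁻¹ • v), h.2⟩
  rw [inv_smul_eq_iff, smul_comm, hA, inv_smul_smul₀ (ne_zero_of_hasEigenvector h)]

end GeneralLinearGroup

theorem sq_sub_trace_mul_add_det_eq_zero {A : Matrix (Fin 2) (Fin 2) K} {l : K}
    (hl : HasEigenvalue (Matrix.toLin' A) l) : l ^ 2 - A.trace * l + A.det = 0 := by
  simpa [Matrix.charpoly_toLin', Matrix.charpoly_fin_two] using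
    (hasEigenvalue_iff_isRoot_charpoly _ _).1 hl

theorem discr_ne_zero_of_hasEigenvalue {A : Matrix (Fin 2) (Fin 2) K} {l m : K}
    (hl : HasEigenvalue (Matrix.toLin' A) l) (hm : HasEigenvalue (Matrix.toLin' A) m)
    (hlm : l ≠ m) : A.discr ≠ 0 := by
  have hl' := sq_sub_trace_mul_add_det_eq_zero hl
  have hm' := sq_sub_trace_mul_add_det_eq_zero hm
  have htrace : A.trace = l + m := by
    refine mul_right_cancel₀ (sub_ne_zero.2 hlm) ?_
    linear_combination hm' - hl'
  have hdiscr : A.discr = (l - m) ^ 2 := by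
    rw [Matrix.discr_fin_two]
    linear_combination (A.trace + m - 3 * l) * htrace - 4 * hl'
  rw [hdiscr]
  exact pow_ne_zero 2 (sub_ne_zero.2 hlm)

theorem discr_eq_zero_of_mulVec_eq {A : Matrix (Fin 2) (Fin 2) K} (hdet : A.det = 1)
    {v : Fin 2 → K} (hv : v ≠ 0) (hAv : A.mulVec v = v) : A.discr = 0 := by
  have h1 : HasEigenvalue (Matrix.toLin' A) 1 :=
    hasEigenvalue_of_hasEigenvector (x := v) ⟨mem_eigenspace_iff.2 (by simpa using hAv), hv⟩
  rw [Matrix.discr_fin_two]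
  linear_combination
    (-A.trace - 2) * sq_sub_trace_mul_add_det_eq_zero h1 + (A.trace - 2) * hdet

theorem discr_mul_scalar {R : Type*} [CommRing R] (A : Matrix (Fin 2) (Fin 2) R) (u : R) :
    (A * Matrix.scalar (Fin 2) u).discr = u ^ 2 * A.discr := by
  simp only [Matrix.discr_fin_two, Matrix.trace_fin_two, Matrix.det_fin_two, Matrix.scalar_apply,
    Matrix.mul_diagonal]
  ring

end LinearAlgebra

variable {K : Type*} [NontriviallyNormedField K]

attribute [local instance] topologyP1

section AffineChart

theorem affinePt_eq_mk_iff {v : Fin 2 → K} (hv : v ≠ 0) {z : K} :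
    affinePt z = Projectivization.mk K v hv ↔ v 1 ≠ 0 ∧ z = v 0 / v 1 := by
  rw [eq_comm, affinePt, Projectivization.mk_eq_mk_iff']
  constructor
  · rintro ⟨t, rfl⟩
    have ht : t ≠ 0 := left_ne_zero_of_smul hv
    simp [ht]
  · rintro ⟨h1, rfl⟩
    refine ⟨v 1, funext (Fin.forall_fin_two.2 ⟨?_, ?_⟩)⟩ <;> simp [mul_div_cancel₀, h1]

theorem affinePt_injective : Function.Injective (affinePt : K → P1 K) := fun z w h => by
  simpa using ((affinePt_eq_mk_iff (by simp)).1 h).2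

theorem inftyPt_ne_affinePt (z : K) : inftyPt K ≠ affinePt z := fun h => by
  simpa using ((affinePt_eq_mk_iff _).1 h.symm).1

theorem inftyPt_notMem_image_affinePt (s : Set K) : inftyPt K ∉ affinePt '' s := by
  rintro ⟨z, -, hz⟩
  exact inftyPt_ne_affinePt z hz.symm

theorem affinePt_mem_image_iff {z : K} {s : Set K} : affinePt z ∈ affinePt '' s ↔ z ∈ s :=
  affinePt_injective.mem_set_image

theorem eq_inftyPt_or_eq_affinePt (x : P1 K) : x = inftyPt K ∨ ∃ z : K, x = affinePt z := by
  induction x using Projectivization.ind with | h v hv =>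
  by_cases h1 : v 1 = 0
  · refine Or.inl ((Projectivization.mk_eq_mk_iff' ..).2 ⟨v 0, ?_⟩)
    exact funext (Fin.forall_fin_two.2 ⟨by simp, by simp [h1]⟩)
  · exact Or.inr ⟨v 0 / v 1, ((affinePt_eq_mk_iff hv).2 ⟨h1, rfl⟩).symm⟩

theorem mk_mem_image_affinePt_iff {v : Fin 2 → K} (hv : v ≠ 0) {s : Set K} :
    Projectivization.mk K v hv ∈ affinePt '' s ↔ v 1 ≠ 0 ∧ v 0 / v 1 ∈ s := by
  simp only [Set.mem_image, affinePt_eq_mk_iff, and_left_comm (b := v 1 ≠ 0), exists_and_left,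
    exists_eq_right]

theorem dist_div_eq {F : Type*} [NormedField F] {z w : F} (hw : w ≠ 0) (a : F) :
    dist (z / w) a = ‖z - a * w‖ / ‖w‖ := by
  rw [dist_eq_norm, ← norm_div, sub_div, mul_div_cancel_right₀ a hw]

theorem mk_mem_image_ball_iff {v : Fin 2 → K} (hv : v ≠ 0) (a : K) (r : ℝ) :
    Projectivization.mk K v hv ∈ affinePt '' Metric.ball a r ↔
      ‖v 0 - a * v 1‖ < r * ‖v 1‖ := by
  rw [mk_mem_image_affinePt_iff]
  by_cases h1 : v 1 = 0
  · simp [h1, (norm_nonneg _).not_gt]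
  · rw [Metric.mem_ball, dist_div_eq h1, div_lt_iff₀ (norm_pos_iff.2 h1), and_iff_right h1]

theorem mk_mem_image_closedBall_iff {v : Fin 2 → K} (hv : v ≠ 0) (a : K) (r : ℝ) :
    Projectivization.mk K v hv ∈ affinePt '' Metric.closedBall a r ↔
      ‖v 0 - a * v 1‖ ≤ r * ‖v 1‖ := by
  rw [mk_mem_image_affinePt_iff]
  by_cases h1 : v 1 = 0
  · have h0 : v 0 ≠ 0 := fun h0 => hv (funext (Fin.forall_fin_two.2 ⟨h0, h1⟩))
    simp [h0, h1]
  · rw [Metric.mem_closedBall, dist_div_eq h1, div_le_iff₀ (norm_pos_iff.2 h1), and_iff_right h1]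

end AffineChart

section Topology

theorem isOpen_image_ball (a : K) {r : ℝ} (hr : 0 < r) : IsOpen (affinePt '' Metric.ball a r) :=
  TopologicalSpace.isOpen_generateFrom_of_mem ⟨a, r, hr, Or.inl rfl⟩

theorem isClosed_image_closedBall (a : K) {r : ℝ} (hr : 0 < r) :
    IsClosed (affinePt '' Metric.closedBall a r) :=
  ⟨TopologicalSpace.isOpen_generateFrom_of_mem ⟨a, r, hr, Or.inr rfl⟩⟩

theorem isOpenMap_affinePt : IsOpenMap (affinePt : K → P1 K) := by
  refine fun U hU => isOpen_iff_mem_nhds.2 (Set.forall_mem_image.2 fun a ha => ?_)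
  obtain ⟨r, hr, hball⟩ := Metric.isOpen_iff.1 hU a ha
  exact mem_of_superset ((isOpen_image_ball a hr).mem_nhds ⟨a, Metric.mem_ball_self hr, rfl⟩)
    (Set.image_mono hball)

theorem isClosed_image_ball [IsUltrametricDist K] (a : K) {r : ℝ} (hr : 0 < r) :
    IsClosed (affinePt '' Metric.ball a r) := by
  rw [← Metric.closedBall_sdiff_sphere, Set.image_sdiff affinePt_injective]
  exact (isClosed_image_closedBall a hr).sdiff
    (isOpenMap_affinePt _ (IsUltrametricDist.isOpen_sphere a hr.ne'))

instance t1Space : T1Space (P1 K) := by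
  refine t1Space_iff_exists_open.2 fun x y hxy => ?_
  rcases eq_inftyPt_or_eq_affinePt x with rfl | ⟨a, rfl⟩
  · obtain ⟨b, rfl⟩ := (eq_inftyPt_or_eq_affinePt y).resolve_left hxy.symm
    exact ⟨_, (isClosed_image_closedBall b one_pos).isOpen_compl,
      inftyPt_notMem_image_affinePt _, not_not_intro ⟨b, by simp, rfl⟩⟩
  · have hclosed : IsClosed (affinePt ⁻¹' {y}) :=
      (Set.subsingleton_singleton.preimage affinePt_injective).isClosed
    exact ⟨_, isOpenMap_affinePt _ hclosed.isOpen_compl, ⟨a, hxy, rfl⟩,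
      fun ⟨_, hz, hzy⟩ => hz hzy⟩

theorem continuous_mk' :
    Continuous (Projectivization.mk' K : {v : Fin 2 → K // v ≠ 0} → P1 K) := by
  have hcoord (i : Fin 2) : Continuous fun v : {v : Fin 2 → K // v ≠ 0} => v.1 i :=
    (continuous_apply i).comp continuous_subtype_val
  have hnum (a : K) : Continuous fun v : {v : Fin 2 → K // v ≠ 0} => ‖v.1 0 - a * v.1 1‖ :=
    ((hcoord 0).sub (continuous_const.mul (hcoord 1))).norm
  have hden (r : ℝ) : Continuous fun v : {v : Fin 2 → K // v ≠ 0} => r * ‖v.1 1‖ :=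
    continuous_const.mul (hcoord 1).norm
  rw [continuous_generateFrom_iff]
  rintro U ⟨a, r, -, rfl | rfl⟩
  · simp only [Set.preimage, Projectivization.mk'_eq_mk, mk_mem_image_ball_iff]
    exact isOpen_lt (hnum a) (hden r)
  · simp only [Set.preimage, Set.mem_compl_iff, Projectivization.mk'_eq_mk,
      mk_mem_image_closedBall_iff, not_le]
    exact isOpen_lt (hden r) (hnum a)

theorem tendsto_mk {ι : Type*} {F : Filter ι} {v : ι → Fin 2 → K} {w : Fin 2 → K}
    (hv : ∀ i, v i ≠ 0) (hw : w ≠ 0) (h : Tendsto v F (𝓝 w)) :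
    Tendsto (fun i => Projectivization.mk K (v i) (hv i)) F (𝓝 (Projectivization.mk K w hw)) :=
  (continuous_mk'.tendsto ⟨w, hw⟩).comp (f := fun i => ⟨v i, hv i⟩) (tendsto_subtype_rng.2 h)

/-- The coordinate `w = 1 / z` of `ℙ¹(K)` around `∞`, as a map to `ℙ¹(K)`. -/
def inftyChart (w : K) : P1 K :=
  Projectivization.mk K ![1, w] (by simp)

theorem compl_image_closedBall_subset_image_inftyChart {ε : ℝ} (hε : 0 < ε) :
    (affinePt '' Metric.closedBall 0 ε⁻¹)ᶜ ⊆ inftyChart '' Metric.ball (0 : K) ε := by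
  intro y hy
  rcases eq_inftyPt_or_eq_affinePt y with rfl | ⟨z, rfl⟩
  · exact ⟨0, Metric.mem_ball_self hε, rfl⟩
  · have hz : ε⁻¹ < ‖z‖ := by
      simpa only [Set.mem_compl_iff, affinePt_mem_image_iff, mem_closedBall_zero_iff, not_le]
        using hy
    have hz0 : z ≠ 0 := norm_pos_iff.1 ((inv_pos.2 hε).trans hz)
    refine ⟨z⁻¹, ?_, ((affinePt_eq_mk_iff _).2 (by simp [hz0])).symm⟩
    rw [mem_ball_zero_iff, norm_inv]
    exact inv_lt_of_inv_lt₀ hε hz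

theorem isOpen_of_isOpen_preimage_charts {U : Set (P1 K)} (haff : IsOpen (affinePt ⁻¹' U))
    (hinf : IsOpen (inftyChart ⁻¹' U)) : IsOpen U := by
  refine isOpen_iff_mem_nhds.2 fun x hx => ?_
  rcases eq_inftyPt_or_eq_affinePt x with rfl | ⟨a, rfl⟩
  · obtain ⟨ε, hε, hball⟩ := Metric.isOpen_iff.1 hinf 0 hx
    exact mem_of_superset
      ((isClosed_image_closedBall 0 (inv_pos.2 hε)).isOpen_compl.mem_nhds
        (inftyPt_notMem_image_affinePt _))
      ((compl_image_closedBall_subset_image_inftyChart hε).trans (Set.image_subset_iff.2 hball))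
  · exact mem_of_superset ((isOpenMap_affinePt _ haff).mem_nhds ⟨a, hx, rfl⟩)
      (Set.image_preimage_subset _ _)

theorem isQuotientMap_mk' :
    IsQuotientMap (Projectivization.mk' K : {v : Fin 2 → K // v ≠ 0} → P1 K) := by
  refine (isQuotientMap_iff _).2 ⟨isCoinducing_iff.2 fun U =>
    ⟨fun hU => isOpen_of_isOpen_preimage_charts ?_ ?_, fun hU => hU.preimage continuous_mk'⟩,
    Quotient.mk''_surjective⟩
  · have hcont : Continuous fun z : K => (⟨![z, 1], by simp⟩ : {v : Fin 2 → K // v ≠ 0}) := by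
      fun_prop
    exact hU.preimage hcont
  · have hcont : Continuous fun w : K => (⟨![1, w], by simp⟩ : {v : Fin 2 → K // v ≠ 0}) := by
      fun_prop
    exact hU.preimage hcont

instance continuousConstSMul : ContinuousConstSMul PGL(2, K) (P1 K) where
  continuous_const_smul g := by
    induction g using Matrix.ProjGenLinGroup.induction_on with | mk A =>
    refine isQuotientMap_mk'.continuous_iff.2 ?_
    refine continuous_mk'.comp
      (f := fun v : {v : Fin 2 → K // v ≠ 0} => ⟨A • v.1, (smul_ne_zero_iff_ne A).2 v.2⟩) ?_
    exact Continuous.subtype_mk (continuous_const.matrix_mulVec continuous_subtype_val) _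

end Topology

section Hyperbolic

theorem attracts_mk {A : GL (Fin 2) K} {l m : K} {e f : Fin 2 → K}
    (he : HasEigenvector (Matrix.toLin' A.1) l e) (hf : HasEigenvector (Matrix.toLin' A.1) m f)
    (hml : ‖m‖ < ‖l‖) :
    Attracts (Matrix.ProjGenLinGroup.mk A) (Projectivization.mk K e he.2)
      (Projectivization.mk K f hf.2) := by
  intro y hy
  induction y using Projectivization.ind with | h v hv =>
  obtain ⟨α, β, rfl⟩ := exists_smul_add_smul_eq_of_hasEigenvector (by simp) he hf
    (fun h => hml.ne' (congrArg norm h)) v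
  have hα : α ≠ 0 := by
    rintro rfl
    exact hy ((Projectivization.mk_eq_mk_iff' ..).2 ⟨β, by simp⟩)
  have hl : l ≠ 0 := norm_pos_iff.1 ((norm_nonneg m).trans_lt hml)
  have hpow (n : ℕ) :
      A ^ n • (α • e + β • f) = (α * l ^ n) • (e + (β / α * (m / l) ^ n) • f) := by
    rw [← pow_smul_add_smul_of_hasEigenvector he hf hl hα, ← Matrix.toLin'_pow]
    rfl
  have hne (n : ℕ) : e + (β / α * (m / l) ^ n) • f ≠ 0 :=
    right_ne_zero_of_smul (hpow n ▸ (smul_ne_zero_iff_ne (A ^ n)).2 hv)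
  have hratio : Tendsto (fun n : ℕ => (m / l) ^ n) atTop (𝓝 0) :=
    tendsto_pow_atTop_nhds_zero_of_norm_lt_one
      (by rwa [norm_div, div_lt_one (norm_pos_iff.2 hl)])
  refine (tendsto_mk hne he.2 ?_).congr fun n => ?_
  · simpa using tendsto_const_nhds.add ((hratio.const_mul (β / α)).smul_const f)
  · rw [← map_pow, Projectivization.PGL.mk_smul_mk, eq_comm, Projectivization.mk_eq_mk_iff']
    exact ⟨α * l ^ n, (hpow n).symm⟩

theorem IsHyperbolic.exists_attracts {g : PGL(2, K)} (hg : IsHyperbolic g) :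
    ∃ x x' : P1 K, Attracts g x x' ∧ Attracts g⁻¹ x' x := by
  obtain ⟨A, rfl, l, m, hl, hm, hlm⟩ := hg
  wlog hml : ‖m‖ < ‖l‖ generalizing l m
  · exact this m l hm hl hlm.symm (hlm.lt_of_le (not_lt.1 hml))
  obtain ⟨e, he⟩ := hl.exists_hasEigenvector
  obtain ⟨f, hf⟩ := hm.exists_hasEigenvector
  refine ⟨_, _, attracts_mk he hf hml, ?_⟩
  rw [← map_inv]
  refine attracts_mk (hasEigenvector_inv hf) (hasEigenvector_inv he) ?_
  rw [norm_inv, norm_inv]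
  exact inv_strictAnti₀ (norm_pos_iff.2 (ne_zero_of_hasEigenvector hf)) hml

theorem IsHyperbolic.exists_forall_mem_closure_orbit {G : Subgroup PGL(2, K)} {g : PGL(2, K)}
    (hyp : IsHyperbolic g) (hg : g ∈ G) {z : P1 K} (hz : g • z = z) :
    ∃ z', ∀ y ≠ z', z ∈ closure (MulAction.orbit G y) := by
  obtain ⟨x, x', hx, hx'⟩ := hyp.exists_attracts
  obtain rfl | rfl := hx.eq_or_eq_of_smul_eq hz
  · exact ⟨x', fun y hy => hx.mem_closure_orbit hg hy⟩
  · exact ⟨x, fun y hy => hx'.mem_closure_orbit (G.inv_mem hg) hy⟩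

theorem IsHyperbolic.discr_ne_zero {A : GL (Fin 2) K}
    (h : IsHyperbolic (Matrix.ProjGenLinGroup.mk A)) : A.1.discr ≠ 0 := by
  obtain ⟨B, hBA, l, m, hl, hm, hlm⟩ := h
  obtain ⟨u, rfl⟩ := Matrix.ProjGenLinGroup.mk_eq_mk_iff.1 hBA
  have hB := discr_ne_zero_of_hasEigenvalue hl hm fun h => hlm (congrArg norm h)
  exact (discr_mul_scalar B.1 u.1).trans_ne (mul_ne_zero (pow_ne_zero 2 u.ne_zero) hB)

theorem not_isHyperbolic_commutator {g k : PGL(2, K)} {x : P1 K} (hg : g • x = x)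
    (hk : k • x = x) : ¬ IsHyperbolic ⁅g, k⁆ := by
  induction g using Matrix.ProjGenLinGroup.induction_on with | mk A =>
  induction k using Matrix.ProjGenLinGroup.induction_on with | mk B =>
  induction x using Projectivization.ind with | h v hv =>
  rw [Projectivization.PGL.mk_smul_mk, Projectivization.mk_eq_mk_iff] at hg hk
  obtain ⟨b, hb⟩ := hg
  obtain ⟨c, hc⟩ := hk
  rw [← map_commutatorElement]
  have hfix : ⁅A, B⁆ • v = v := commutator_smul_eq_of_smul_eq (U := Kˣ) hb.symm hc.symm
  refine fun h => h.discr_ne_zero (discr_eq_zero_of_mulVec_eq ?_ hv hfix)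
  rw [← Matrix.GeneralLinearGroup.val_det_apply, map_commutatorElement,
    commutatorElement_eq_one_iff_mul_comm.2 (mul_comm _ _), Units.val_one]

theorem mul_comm_of_mem_fixedPoints {G : Subgroup PGL(2, K)}
    (hG : ∀ g ∈ G, g ≠ 1 → IsHyperbolic g) {x : P1 K}
    (hx : x ∈ MulAction.fixedPoints G (P1 K)) {g k : PGL(2, K)} (hg : g ∈ G) (hk : k ∈ G) :
    g * k = k * g := by
  refine commutatorElement_eq_one_iff_mul_comm.1 (of_not_not fun hne => ?_)
  have hmem : ⁅g, k⁆ ∈ G :=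
    G.mul_mem (G.mul_mem (G.mul_mem hg hk) (G.inv_mem hg)) (G.inv_mem hk)
  exact not_isHyperbolic_commutator (hx ⟨g, hg⟩) (hx ⟨k, hk⟩) (hG _ hmem hne)

end Hyperbolic

section BadPoints

variable {G : Subgroup PGL(2, K)}

theorem smul_mem_fixedPts {g : PGL(2, K)} (hg : g ∈ G) {x : P1 K} (hx : x ∈ fixedPts G) :
    g • x ∈ fixedPts G := by
  obtain ⟨k, hk, hk1, hkx⟩ := hx
  refine ⟨g * k * g⁻¹, G.mul_mem (G.mul_mem hg hk) (G.inv_mem hg), mt conj_eq_one_iff.1 hk1, ?_⟩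
  rw [mul_smul, inv_smul_smul, mul_smul, hkx]

theorem smul_mem_badPts {g : PGL(2, K)} (hg : g ∈ G) {x : P1 K} (hx : x ∈ badPts G) :
    g • x ∈ badPts G := by
  refine hx.imp (smul_mem_fixedPts hg) fun hx => ?_
  have himage : (g • ·) '' fixedPts G ⊆ fixedPts G :=
    Set.image_subset_iff.2 fun y => smul_mem_fixedPts hg
  exact derivedSet_mono _ _ himage ((continuous_const_smul g).image_derivedSet
    (MulAction.injective g) ⟨x, hx, rfl⟩)

theorem orbit_subset_badPts {x : P1 K} (hx : x ∈ badPts G) : MulAction.orbit G x ⊆ badPts G := by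
  rintro _ ⟨g, rfl⟩
  exact smul_mem_badPts g.2 hx

theorem badPts_subset_closure : badPts G ⊆ closure (fixedPts G) :=
  (closure_eq_self_union_derivedSet (fixedPts G)).ge

theorem notMem_fixedPoints_of_nonempty_fixedPts (hG : ∀ g ∈ G, g ≠ 1 → IsHyperbolic g) {x : P1 K}
    (h : (∃ g₁ ∈ G, ∃ g₂ ∈ G, g₁ * g₂ ≠ g₂ * g₁) ∨ x ∉ badPts G) (hne : (fixedPts G).Nonempty) :
    x ∉ MulAction.fixedPoints G (P1 K) := by
  intro hx
  rcases h with ⟨g₁, h₁, g₂, h₂, hncomm⟩ | hbad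
  · exact hncomm (mul_comm_of_mem_fixedPoints hG hx h₁ h₂)
  · obtain ⟨_, g, hg, hg1, -⟩ := hne
    exact hbad (Or.inl ⟨g, hg, hg1, hx ⟨g, hg⟩⟩)

theorem fixedPts_subset_closure_orbit (hG : ∀ g ∈ G, g ≠ 1 → IsHyperbolic g) {x : P1 K}
    (hx : (fixedPts G).Nonempty → x ∉ MulAction.fixedPoints G (P1 K)) :
    fixedPts G ⊆ closure (MulAction.orbit G x) := by
  rintro z ⟨g, hg, hg1, hgz⟩
  obtain ⟨z', hz'⟩ := (hG g hg hg1).exists_forall_mem_closure_orbit hg hgz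
  by_cases hxz' : x = z'
  · obtain ⟨k, hk⟩ := not_forall.1 (hx ⟨z, g, hg, hg1, hgz⟩)
    rw [← MulAction.orbit_smul k x]
    exact hz' _ (hxz' ▸ hk)
  · exact hz' x hxz'

end BadPoints

section Subtree

theorem spannedSubtree_mono {S T : Set (P1 K)} (h : S ⊆ T) :
    spannedSubtree S ⊆ spannedSubtree T :=
  Set.sdiff_subset_sdiff_left
    (Set.biUnion_mono h fun _ _ => Set.biUnion_mono h fun _ _ => subset_rfl)

theorem mem_spannedSubtree_iff {S : Set (P1 K)} {P : P1an K} :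
    P ∈ spannedSubtree S ↔ ∃ (b : K) (t : ℝ) (ht : 0 < t), P = ballPt b t ht ∧ affinePt b ∈ S ∧
      ¬ S ⊆ affinePt '' Metric.ball b t := by
  have hball {a b : K} {t : ℝ} :
      affinePt b ∉ affinePt '' Metric.ball a t ↔ t ≤ ‖a - b‖ := by
    rw [affinePt_mem_image_iff, Metric.mem_ball, dist_comm, dist_eq_norm, not_lt]
  constructor
  · rintro ⟨hP, hP1⟩
    simp only [Set.mem_iUnion] at hP
    obtain ⟨x, hx, y, hy, rfl | rfl | ⟨a, b, rfl, rfl, ⟨t, ht, htab, rfl⟩ | ⟨t, ht, htab, rfl⟩⟩ |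
      ⟨a, rfl, rfl, t, ht, rfl⟩ | ⟨b, rfl, rfl, t, ht, rfl⟩⟩ := hP
    · exact absurd ⟨_, rfl⟩ hP1
    · exact absurd ⟨_, rfl⟩ hP1
    · exact ⟨a, t, ht, rfl, hx, fun hS => hball.2 htab (hS hy)⟩
    · exact ⟨b, t, ht, rfl, hy, fun hS => hball.2 (norm_sub_rev a b ▸ htab) (hS hx)⟩
    · exact ⟨a, t, ht, rfl, hx, fun hS => inftyPt_notMem_image_affinePt _ (hS hy)⟩
    · exact ⟨b, t, ht, rfl, hy, fun hS => inftyPt_notMem_image_affinePt _ (hS hx)⟩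
  · rintro ⟨b, t, ht, rfl, hb, hS⟩
    obtain ⟨y, hy, hyb⟩ := Set.not_subset.1 hS
    refine ⟨Set.mem_biUnion hb (Set.mem_biUnion hy ?_), fun ⟨_, h⟩ => by cases h⟩
    rcases eq_inftyPt_or_eq_affinePt y with rfl | ⟨c, rfl⟩
    · exact Or.inr (Or.inr (Or.inr (Or.inl ⟨b, rfl, rfl, t, ht, rfl⟩)))
    · exact Or.inr (Or.inr (Or.inl ⟨b, c, rfl, rfl, Or.inl ⟨t, ht, hball.1 hyb, rfl⟩⟩))

variable [IsUltrametricDist K]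

theorem ballPt_eq_of_mem_ball {a b : K} {t : ℝ} (ht : 0 < t) (hb : b ∈ Metric.ball a t) :
    ballPt a t ht = ballPt b t ht :=
  congrArg P1an.ofBall (Subtype.ext
    (IsUltrametricDist.closedBall_eq_of_mem (Metric.ball_subset_closedBall hb)))

theorem spannedSubtree_subset_of_subset_closure {S T : Set (P1 K)} (h : S ⊆ closure T) :
    spannedSubtree S ⊆ spannedSubtree T := by
  intro P hP
  obtain ⟨a, t, ht, rfl, ha, hS⟩ := mem_spannedSubtree_iff.1 hP
  obtain ⟨_, ⟨b, hb, rfl⟩, hbT⟩ := mem_closure_iff.1 (h ha) _ (isOpen_image_ball a ht)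
    ⟨a, Metric.mem_ball_self ht, rfl⟩
  refine mem_spannedSubtree_iff.2 ⟨b, t, ht, ballPt_eq_of_mem_ball ht hb, hbT, fun hT => hS ?_⟩
  rw [← IsUltrametricDist.ball_eq_of_mem hb] at hT
  exact h.trans (closure_minimal hT (isClosed_image_ball a ht))

end Subtree

end Mumford

theorem mainTheorem8_general {K : Type*} [NontriviallyNormedField K] [IsUltrametricDist K]
    (G : Subgroup PGL(2, K)) (hG : ∀ g ∈ G, g ≠ 1 → Mumford.IsHyperbolic g) (x : Mumford.P1 K)
    (h : (∃ g₁ ∈ G, ∃ g₂ ∈ G, g₁ * g₂ ≠ g₂ * g₁) ∨ x ∉ Mumford.badPts G) :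
    Mumford.spannedSubtree (Mumford.badPts G) ⊆ Mumford.spannedSubtree (MulAction.orbit G x) ∧
      (x ∈ Mumford.badPts G →
        Mumford.spannedSubtree (MulAction.orbit G x) =
          Mumford.spannedSubtree (Mumford.badPts G)) := by
  let _ := Mumford.topologyP1 K
  have hfix : Mumford.fixedPts G ⊆ closure (MulAction.orbit G x) :=
    Mumford.fixedPts_subset_closure_orbit hG
      (Mumford.notMem_fixedPoints_of_nonempty_fixedPts hG h)
  have hbad : Mumford.badPts G ⊆ closure (MulAction.orbit G x) :=
    Mumford.badPts_subset_closure.trans (closure_minimal hfix isClosed_closure)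
  have hsub := Mumford.spannedSubtree_subset_of_subset_closure hbad
  exact ⟨hsub, fun hx =>
    (Mumford.spannedSubtree_mono (Mumford.orbit_subset_badPts hx)).antisymm hsub⟩

theorem mainTheorem8 {K : Type*} [NontriviallyNormedField K] [IsUltrametricDist K]
    [CompleteSpace K] [IsAlgClosed K]
    (G : Subgroup PGL(2, K)) (hG : Mumford.IsSchottky G) (a : K)
    (h : (∃ g₁ ∈ G, ∃ g₂ ∈ G, g₁ * g₂ ≠ g₂ * g₁) ∨ Mumford.affinePt a ∉ Mumford.badPts G) :
    Mumford.spannedSubtree (Mumford.badPts G) ⊆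
        Mumford.spannedSubtree (MulAction.orbit G (Mumford.affinePt a)) ∧
      (Mumford.affinePt a ∈ Mumford.badPts G →
        Mumford.spannedSubtree (MulAction.orbit G (Mumford.affinePt a)) =
          Mumford.spannedSubtree (Mumford.badPts G)) := by
  exact mainTheorem8_general G hG.2 (Mumford.affinePt a) h
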